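/- Let $\mathbb U$ be the open unit disc, let $H^2(\mathbb U)$ be the Hardy space of holomorphic functions on $\mathbb U$ with square-summable Maclaurin coefficients, with inner product $\langle f,g\rangle=\sum_{n\ge 0}\hat f(n)\overline{\hat g(n)}$. Let $\varphi$ and $\psi$ be holomorphic on $\mathbb U$ with $\varphi(\mathbb U)\subseteq\mathbb U$, and suppose that $W_{\psi,\varphi}f=\psi\cdot(f\circ\varphi)$ defines a bounded operator on $H^2(\mathbb U)$ that is unitary. (a) If $\varphi$ fixes a point $p\in\mathbb U$ (in particular, if $\varphi$ is an elliptic automorphism of $\mathbb U$ with fixed point $p\in\mathbb U$), then $|\varphi'(p)|=1$ and the spectrum of $W_{\psi,\varphi}$ is the closure of $\{\psi(p)\varphi'(p)^n : n=0,1,2,\ldots\}$. (b) If $\varphi$ is hyperbolic or parabolic, then the spectrum of $W_{\psi,\varphi}$ is the whole unit circle $\{\lambda\in\mathbb C:|\lambda|=1\}$. Here $\varphi$ is called hyperbolic (respectively parabolic) if there is a point $\omega$ with $|\omega|=1$ such that the iterates $\varphi^{[n]}(z)$ converge to $\omega$ for every $z\in\mathbb U$ (the Denjoy–Wolff point of $\varphi$),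 $\varphi$ has angular limit $\omega$ at $\omega$, and the angular derivative of $\varphi$ at $\omega$, i.e. the angular limit of $\frac{\varphi(z)-\omega}{z-\omega}$ at $\omega$, exists and satisfies $0<\varphi'(\omega)<1$ (respectively $\varphi'(\omega)=1$). -/

import Mathlib

open Filter Topology Metric

noncomputable section

namespace WCO

/-- The open unit disc `𝕌` of the complex plane. -/
abbrev disc : Set ℂ := Metric.ball (0 : ℂ) 1

/-! ### The Hardy space `H²(𝕌)` -/

/-- The functions `f : 𝕌 → ℂ` given on all of `𝕌` by a power series `∑ aₙ zⁿ` with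
`∑ |aₙ|² < ∞`, that is, the holomorphic functions on `𝕌` whose Maclaurin coefficients are
square summable. -/
def hardySubmodule : Submodule ℂ (disc → ℂ) where
  carrier := {f | ∃ a : ℕ → ℂ, Memℓp a 2 ∧
    ∀ z : disc, HasSum (fun n => a n * (z : ℂ) ^ n) (f z)}
  zero_mem' := ⟨0, zero_memℓp, fun z => by simp [hasSum_zero]⟩
  add_mem' := by
    rintro f g ⟨a, ha, hfa⟩ ⟨b, hb, hgb⟩
    exact ⟨a + b, ha.add hb, fun z => by simpa [add_mul] using (hfa z).add (hgb z)⟩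
  smul_mem' := by
    rintro c f ⟨a, ha, hfa⟩
    exact ⟨c • a, ha.const_smul c, fun z => by
      simpa [mul_assoc] using (hfa z).mul_left c⟩

/-- The Hardy space `H²(𝕌)`. -/
def Hardy : Type := hardySubmodule

namespace Hardy

instance : AddCommGroup Hardy := inferInstanceAs (AddCommGroup hardySubmodule)

instance : Module ℂ Hardy := inferInstanceAs (Module ℂ hardySubmodule)

/-- An element of `H²(𝕌)` is a function on `𝕌`. -/
instance : CoeFun Hardy (fun _ => disc → ℂ) := ⟨fun f => f.1⟩

/-- A square summable sequence is the sequence of Maclaurin coefficients of an element of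
`H²(𝕌)`. -/
theorem exists_of_coeff (a : lp (fun _ : ℕ => ℂ) 2) :
    ∃ f : Hardy, ∀ z : disc, HasSum (fun n => a n * (z : ℂ) ^ n) (f z) := by
  have hs : ∀ z : disc, Summable (fun n => a n * (z : ℂ) ^ n) := by
    intro z
    have hz : ‖(z : ℂ)‖ < 1 := mem_ball_zero_iff.mp z.2
    refine Summable.of_norm_bounded
      ((summable_geometric_of_lt_one (norm_nonneg _) hz).mul_left ‖a‖) fun n => ?_
    rw [norm_mul, norm_pow]
    exact mul_le_mul_of_nonneg_right (lp.norm_apply_le_norm (by simp) a n) (by positivity)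
  exact ⟨⟨fun z => ∑' n, a n * (z : ℂ) ^ n, a, a.2, fun z => (hs z).hasSum⟩,
    fun z => (hs z).hasSum⟩

/-- Maclaurin coefficients are unique. -/
theorem coeff_unique {f : disc → ℂ} {a b : ℕ → ℂ}
    (ha : ∀ z : disc, HasSum (fun n => a n * (z : ℂ) ^ n) (f z))
    (hb : ∀ z : disc, HasSum (fun n => b n * (z : ℂ) ^ n) (f z)) : a = b := by
  classical
  let F : ℂ → ℂ := fun z => if h : z ∈ disc then f ⟨z, h⟩ else 0
  have key : ∀ c : ℕ → ℂ, (∀ z : disc, HasSum (fun n => c n * (z : ℂ) ^ n) (f z)) →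
      HasFPowerSeriesAt F (FormalMultilinearSeries.ofScalars ℂ c) 0 := by
    intro c hc
    rw [hasFPowerSeriesAt_iff]
    filter_upwards [Metric.ball_mem_nhds (0 : ℂ) one_pos] with z hz
    have h1 : F (0 + z) = f ⟨z, hz⟩ := by
      have h2 : (0 : ℂ) + z = z := zero_add z
      rw [h2]
      exact dif_pos hz
    rw [h1]
    simpa [FormalMultilinearSeries.coeff_ofScalars, mul_comm] using hc ⟨z, hz⟩
  have h := (key a ha).eq_formalMultilinearSeries (key b hb)
  funext n
  have h3 := congrArg (fun p => FormalMultilinearSeries.coeff p n) h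
  simpa [FormalMultilinearSeries.coeff_ofScalars] using h3

/-- The Hilbert space `ℓ²` of square summable complex sequences. -/
abbrev EllTwo : Type := lp (fun _ : ℕ => ℂ) 2

/-- The linear map from `H²(𝕌)` to `ℓ²` that sends `f` to the sequence of its Maclaurin
coefficients. -/
def coeffLin : Hardy →ₗ[ℂ] EllTwo where
  toFun f := ⟨f.2.choose, f.2.choose_spec.1⟩
  map_add' f g := Subtype.ext <| coeff_unique (f + g).2.choose_spec.2 fun z => by
    have h := (f.2.choose_spec.2 z).add (g.2.choose_spec.2 z)
    simp only [← add_mul] at h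
    exact h
  map_smul' c f := Subtype.ext <| coeff_unique (c • f).2.choose_spec.2 fun z => by
    have h := (f.2.choose_spec.2 z).mul_left c
    simp only [← mul_assoc] at h
    exact h

theorem hasSum_coeffLin (f : Hardy) (z : disc) :
    HasSum (fun n => coeffLin f n * (z : ℂ) ^ n) (f z) :=
  f.2.choose_spec.2 z

theorem coeffLin_bijective : Function.Bijective coeffLin := by
  refine ⟨fun f g h => Subtype.ext <| funext fun z => ?_, fun a => ?_⟩
  · have h2 := hasSum_coeffLin f z
    rw [h] at h2
    exact h2.unique (hasSum_coeffLin g z)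
  · obtain ⟨f, hf⟩ := exists_of_coeff a
    exact ⟨f, Subtype.ext (coeff_unique (hasSum_coeffLin f) hf)⟩

/-- The linear isomorphism from `H²(𝕌)` onto `ℓ²` given by the Maclaurin coefficients. -/
def coeff : Hardy ≃ₗ[ℂ] EllTwo := LinearEquiv.ofBijective coeffLin coeffLin_bijective

theorem hasSum_coeff (f : Hardy) (z : disc) :
    HasSum (fun n => coeff f n * (z : ℂ) ^ n) (f z) :=
  hasSum_coeffLin f z

/-- The norm `‖f‖ = (∑ |f̂(n)|²)^(1/2)`. -/
instance : NormedAddCommGroup Hardy :=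
  NormedAddCommGroup.induced Hardy EllTwo coeff coeff.injective

/-- The inner product `∑ conj (f̂(n)) * ĝ(n)` (conjugate linear in the first variable, as
everywhere in Mathlib). -/
instance : InnerProductSpace ℂ Hardy where
  inner f g := inner ℂ (coeff f) (coeff g)
  norm_smul_le c f := by
    change ‖coeff (c • f)‖ ≤ ‖c‖ * ‖coeff f‖
    rw [map_smul]
    exact norm_smul_le c (coeff f)
  norm_sq_eq_re_inner f := InnerProductSpace.norm_sq_eq_re_inner (𝕜 := ℂ) (coeff f)
  conj_inner_symm f g := InnerProductSpace.conj_inner_symm (coeff f) (coeff g)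
  add_left f g h := by
    change inner ℂ (coeff (f + g)) (coeff h) = _
    rw [map_add]
    exact InnerProductSpace.add_left _ _ _
  smul_left f g c := by
    change inner ℂ (coeff (c • f)) (coeff g) = _
    rw [map_smul]
    exact InnerProductSpace.smul_left _ _ _

theorem inner_eq_tsum (f g : Hardy) :
    inner ℂ f g = ∑' n, (starRingEnd ℂ) (coeff f n) * coeff g n := by
  change inner ℂ (coeff f) (coeff g) = _
  rw [lp.inner_eq_tsum]
  exact tsum_congr fun n => by simp [mul_comm]

instance : CompleteSpace Hardy := by
  have hi : Isometry (coeff : Hardy → EllTwo) :=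
    AddMonoidHomClass.isometry_of_norm coeff fun _ => rfl
  exact ((IsometryEquiv.mk coeff.toEquiv hi).completeSpace_iff).2 inferInstance

end Hardy

/-! ### Weighted composition operators -/

/-- The bounded operator `W` on `H²(𝕌)` is the weighted composition operator
`W_{ψ,φ} f = ψ · (f ∘ φ)`, where `φ` maps `𝕌` into `𝕌`. -/
def IsWeightedComposition (ψ φ : ℂ → ℂ) (hφ : Set.MapsTo φ disc disc)
    (W : Hardy →L[ℂ] Hardy) : Prop :=
  ∀ (f : Hardy) (z : disc), (W f) z = ψ z * f (hφ.restrict φ disc disc z)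

/-! ### Self-maps of the disc with boundary Denjoy-Wolff point -/

/-- The non-tangential approach region with vertex `ω ∈ ∂𝕌` and aperture `M`. -/
def approachRegion (ω : ℂ) (M : ℝ) : Set ℂ := {z | z ∈ disc ∧ ‖z - ω‖ < M * (1 - ‖z‖)}

/-- `g` has angular (non-tangential) limit `l` at the boundary point `ω`. -/
def HasAngularLimit (g : ℂ → ℂ) (ω l : ℂ) : Prop :=
  ∀ M : ℝ, Tendsto g (𝓝[approachRegion ω M] ω) (𝓝 l)

/-- The boundary point `ω` is fixed by `φ` in the sense of angular limits, and `φ` has angular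
derivative `d` there. -/
def FixesWithAngularDeriv (φ : ℂ → ℂ) (ω d : ℂ) : Prop :=
  HasAngularLimit φ ω ω ∧ HasAngularLimit (fun z => (φ z - ω) / (z - ω)) ω d

/-- `ω` is the Denjoy-Wolff point of the self-map `φ` of `𝕌`: the iterates of `φ` converge to
`ω` at every point of `𝕌`. -/
def IsDenjoyWolffPoint (φ : ℂ → ℂ) (ω : ℂ) : Prop :=
  ∀ z ∈ disc, Tendsto (fun n : ℕ => φ^[n] z) atTop (𝓝 ω)

/-- `φ` is hyperbolic: its Denjoy-Wolff point `ω` lies on the unit circle and the angular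
derivative satisfies `0 < φ'(ω) < 1`. -/
def IsHyperbolic (φ : ℂ → ℂ) : Prop :=
  ∃ ω : ℂ, ‖ω‖ = 1 ∧ IsDenjoyWolffPoint φ ω ∧
    ∃ b : ℝ, 0 < b ∧ b < 1 ∧ FixesWithAngularDeriv φ ω (b : ℂ)

/-- `φ` is parabolic: its Denjoy-Wolff point `ω` lies on the unit circle and the angular
derivative satisfies `φ'(ω) = 1`. -/
def IsParabolic (φ : ℂ → ℂ) : Prop :=
  ∃ ω : ℂ, ‖ω‖ = 1 ∧ IsDenjoyWolffPoint φ ω ∧ FixesWithAngularDeriv φ ω 1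

end WCO

end

/-! Write `K_w(z) = (1 - conj w * z)⁻¹` for the reproducing kernel. Since `W* K_w = conj (ψ w) K_{φ
w}` and `W W* = 1`, comparing inner products of kernels gives `1 - conj (φ w) φ(z) = ψ(z) conj (ψ w)
(1 - conj w z)` (`kernel_identity`). This rigid identity determines `φ` and `ψ` up to constants.

Interior fixed point `p`: with `b` the disc automorphism exchanging `p` and `0`, the identity forces
`b ∘ φ = φ'(p) b` and `|φ'(p)| = 1`. The functions `bⁿ K_p` are then eigenvectors for `ψ(p) φ'(p)ⁿ`.
They are total, because every kernel is a geometric series in them, and the continuous functional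
calculus gives the spectrum as the closure of the eigenvalues.

Boundary Denjoy-Wolff point `ω`: letting `w` tend to `ω` along an orbit gives `ω - φ = η ψ (ω - z)`,
and in the half-plane coordinate `C = (ω + z) / (ω - z)` the symbol becomes `C ↦ r C + i c` with `r
= |η|⁻²`. If `r ≠ 1`, multiplication by imaginary powers of a translate of `C` conjugates `W` to its
rotations, so the nonempty spectrum is the whole circle. If `r = 1`, truncations of `(C + 1) exp (-s
C)` are approximate eigenvectors for every unimodular value. -/

namespace WCO

open MeasureTheory AddCircle

/-! ### Parseval's identity and the size of products -/

/-- Pythagoras' theorem for a convergent series along an orthonormal sequence. -/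
theorem hasSum_sq_of_orthonormal {H : Type*} [NormedAddCommGroup H] [InnerProductSpace ℂ H]
    {v : ℕ → H} (hv : Orthonormal ℂ v) {c : ℕ → ℂ} {g : H} (h : HasSum (fun n => c n • v n) g) :
    HasSum (fun n => ‖c n‖ ^ 2) (‖g‖ ^ 2) := by
  have h1 := (h.norm.pow 2)
  refine h1.congr fun s => ?_
  have h2 := hv.inner_sum c c s
  have h3 := inner_self_eq_norm_sq_to_K (𝕜 := ℂ) (∑ i ∈ s, c i • v i)
  rw [h2] at h3
  have h4 : ((∑ i ∈ s, ‖c i‖ ^ 2 : ℝ) : ℂ) = ((‖∑ i ∈ s, c i • v i‖ ^ 2 : ℝ) : ℂ) := by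
    push_cast
    rw [show ((‖∑ i ∈ s, c i • v i‖ : ℝ) : ℂ) ^ 2 = _ from h3.symm]
    exact Finset.sum_congr rfl fun i _ => (Complex.conj_mul' (c i)).symm
  exact_mod_cast h4.symm

/-- Parseval's identity on the circle of radius `r` for an absolutely convergent power series. -/
theorem exists_circle_parseval (a : ℕ → ℂ) (r : ℝ) (hr : 0 ≤ r)
    (ha : Summable fun n => ‖a n‖ * r ^ n) :
    ∃ G : C(AddCircle (1 : ℝ), ℂ),
      (∀ t, HasSum (fun n => a n * ((r : ℂ) * (toCircle t : ℂ)) ^ n) (G t)) ∧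
      HasSum (fun n => (‖a n‖ * r ^ n) ^ 2)
        (‖ContinuousMap.toLp (E := ℂ) 2 (haarAddCircle (T := 1)) ℂ G‖ ^ 2) := by
  have hs : Summable fun n : ℕ => (a n * (r : ℂ) ^ n) • fourier (T := 1) n := by
    refine Summable.of_norm ?_
    simpa [norm_smul, abs_of_nonneg hr, fourier_norm, -fourier_apply] using ha
  refine ⟨∑' n : ℕ, (a n * (r : ℂ) ^ n) • fourier (T := 1) n, fun t => ?_, ?_⟩
  · have := hs.hasSum.map (ContinuousMap.evalCLM ℂ t) (ContinuousMap.evalCLM ℂ t).continuous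
    convert! this using 2 with n
    simp [mul_pow, mul_assoc, toCircle_nsmul]
  · have h1 := hs.hasSum.mapL (ContinuousMap.toLp (E := ℂ) 2 (haarAddCircle (T := 1)) ℂ)
    have h2 : Orthonormal ℂ (fun n : ℕ => fourierLp (T := 1) 2 (n : ℤ)) :=
      orthonormal_fourier.comp _ Nat.cast_injective
    simp only [map_smul] at h1
    have := hasSum_sq_of_orthonormal h2 h1
    simpa [abs_of_nonneg hr] using this

theorem exists_powerSeries {h : ℂ → ℂ} (hh : DifferentiableOn ℂ h disc) :
    ∃ c : ℕ → ℂ, ∀ z ∈ disc, HasSum (fun n => c n * z ^ n) (h z) := by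
  refine ⟨fun n => (n.factorial : ℂ)⁻¹ * iteratedDeriv n h 0, fun z hz => ?_⟩
  have := Complex.hasSum_taylorSeries_on_ball (c := 0) (r := 1) (f := h) (by simpa using hh)
    (by simpa using hz)
  convert! this using 2 with n
  rw [sub_zero, smul_eq_mul, smul_eq_mul]
  ring

/-- On each circle of radius `r < 1`, Parseval's identity turns the pointwise bound `|h F| ≤ C |F|`
into a bound on coefficients. This is the estimate behind bounded multipliers on `H²`. -/
theorem sum_sq_le_of_mul_bounded {a c : ℕ → ℂ} {F h : disc → ℂ} {C : ℝ}
    (ha : Memℓp a 2) (hF : ∀ z : disc, HasSum (fun n => a n * (z : ℂ) ^ n) (F z))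
    (hc : ∀ z : disc, HasSum (fun n => c n * (z : ℂ) ^ n) (h z * F z))
    (hb : ∀ z, ‖h z‖ ≤ C) (s : Finset ℕ) :
    ∑ n ∈ s, ‖c n‖ ^ 2 ≤ C ^ 2 * ∑' n, ‖a n‖ ^ 2 := by
  have hsa : Summable fun n => ‖a n‖ ^ 2 := by
    simpa using ha.summable (by norm_num)
  have key : ∀ r : ℝ, 0 ≤ r → r < 1 →
      ∑ n ∈ s, (‖c n‖ * r ^ n) ^ 2 ≤ C ^ 2 * ∑' n, ‖a n‖ ^ 2 := by
    intro r hr hr1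
    have hrd : ((r : ℝ) : ℂ) ∈ disc := by
      simpa [abs_of_nonneg hr] using hr1
    have hs : ∀ (b : ℕ → ℂ) (B : disc → ℂ), (∀ z : disc, HasSum (fun n => b n * (z : ℂ) ^ n) (B z)) →
        Summable fun n => ‖b n‖ * r ^ n := by
      intro b B hB
      simpa [abs_of_nonneg hr] using (hB ⟨r, hrd⟩).summable.norm
    obtain ⟨G, hG, hGn⟩ := exists_circle_parseval a r hr (hs a F hF)
    obtain ⟨P, hP, hPn⟩ := exists_circle_parseval c r hr (hs c _ hc)
    have hrt : ∀ t : AddCircle (1 : ℝ), (r : ℂ) * (toCircle t : ℂ) ∈ disc := by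
      intro t
      simpa [abs_of_nonneg hr, Circle.norm_coe] using hr1
    have hPG : ∀ t, ‖P t‖ ≤ C * ‖G t‖ := by
      intro t
      rw [(hP t).unique (hc ⟨_, hrt t⟩), (hG t).unique (hF ⟨_, hrt t⟩), norm_mul]
      gcongr
      exact hb _
    have hn : ‖ContinuousMap.toLp (E := ℂ) 2 (haarAddCircle (T := 1)) ℂ P‖ ≤
        C * ‖ContinuousMap.toLp (E := ℂ) 2 (haarAddCircle (T := 1)) ℂ G‖ := by
      apply Lp.norm_le_mul_norm_of_ae_le_mul
      filter_upwards [ContinuousMap.coeFn_toLp (p := 2) (𝕜 := ℂ) (haarAddCircle (T := 1)) P,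
        ContinuousMap.coeFn_toLp (p := 2) (𝕜 := ℂ) (haarAddCircle (T := 1)) G] with t h1 h2
      rw [h1, h2]
      exact hPG t
    calc ∑ n ∈ s, (‖c n‖ * r ^ n) ^ 2
        ≤ ‖ContinuousMap.toLp (E := ℂ) 2 (haarAddCircle (T := 1)) ℂ P‖ ^ 2 :=
          sum_le_hasSum s (fun _ _ => by positivity) hPn
      _ ≤ (C * ‖ContinuousMap.toLp (E := ℂ) 2 (haarAddCircle (T := 1)) ℂ G‖) ^ 2 := by gcongr
      _ = C ^ 2 * ∑' n, (‖a n‖ * r ^ n) ^ 2 := by rw [mul_pow, hGn.tsum_eq]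
      _ ≤ C ^ 2 * ∑' n, ‖a n‖ ^ 2 := by
          gcongr C ^ 2 * ?_
          refine hGn.summable.tsum_le_tsum (fun n => ?_) hsa
          gcongr
          exact mul_le_of_le_one_right (norm_nonneg _) (pow_le_one₀ hr hr1.le)
  -- The sum over `s` is finite, hence continuous in `r`, so the bound survives `r → 1`.
  have hlim : Tendsto (fun r : ℝ => ∑ n ∈ s, (‖c n‖ * r ^ n) ^ 2) (𝓝[<] 1)
      (𝓝 (∑ n ∈ s, ‖c n‖ ^ 2)) := by
    have : Continuous fun r : ℝ => ∑ n ∈ s, (‖c n‖ * r ^ n) ^ 2 := by fun_prop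
    simpa using (this.tendsto 1).mono_left nhdsWithin_le_nhds
  refine le_of_tendsto hlim ?_
  filter_upwards [Ioo_mem_nhdsLT (show (0 : ℝ) < 1 by norm_num)] with r hr
  exact key r hr.1.le hr.2

/-! ### Bounded multipliers and reproducing kernels -/

namespace Hardy

@[ext]
theorem ext {f g : Hardy} (h : ∀ z : disc, f z = g z) : f = g :=
  Subtype.ext (funext h)

@[simp] theorem add_apply (f g : Hardy) (z : disc) : (f + g) z = f z + g z := rfl

@[simp] theorem sub_apply (f g : Hardy) (z : disc) : (f - g) z = f z - g z := rfl

@[simp] theorem zero_apply (z : disc) : (0 : Hardy) z = 0 := rfl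

@[simp] theorem smul_apply (c : ℂ) (f : Hardy) (z : disc) : (c • f) z = c * f z := rfl

theorem norm_sq_eq (f : Hardy) : ‖f‖ ^ 2 = ∑' n, ‖coeff f n‖ ^ 2 := by
  change ‖coeff f‖ ^ 2 = _
  simpa using lp.norm_rpow_eq_tsum (p := 2) (by norm_num) (coeff f)

theorem coeff_eq {f : Hardy} {a : ℕ → ℂ}
    (ha : ∀ z : disc, HasSum (fun n => a n * (z : ℂ) ^ n) (f z)) : ⇑(coeff f) = a :=
  coeff_unique (hasSum_coeff f) ha

theorem exists_of_hasSum {f : disc → ℂ} {a : ℕ → ℂ} (ha : Memℓp a 2)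
    (hf : ∀ z : disc, HasSum (fun n => a n * (z : ℂ) ^ n) (f z)) :
    ∃ g : Hardy, (∀ z, g z = f z) ∧ ⇑(coeff g) = a := by
  let g : Hardy := (⟨f, a, ha, hf⟩ : hardySubmodule)
  exact ⟨g, fun _ => rfl, coeff_eq (f := g) hf⟩

theorem exists_mul {h : ℂ → ℂ} (hh : DifferentiableOn ℂ h disc) {C : ℝ} (hC : 0 ≤ C)
    (hb : ∀ z ∈ disc, ‖h z‖ ≤ C) (f : Hardy) :
    ∃ g : Hardy, (∀ z : disc, g z = h z * f z) ∧ ‖g‖ ≤ C * ‖f‖ := by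
  obtain ⟨b, hbs⟩ := exists_powerSeries hh
  set c : ℕ → ℂ := fun n => ∑ kl ∈ Finset.HasAntidiagonal.antidiagonal n, b kl.1 * coeff f kl.2 with hcdef
  have hc : ∀ z : disc, HasSum (fun n => c n * (z : ℂ) ^ n) (h z * f z) := by
    intro z
    have h1 := hbs z z.2
    have h2 := hasSum_coeff f z
    have h3 := tsum_mul_tsum_eq_tsum_sum_antidiagonal_of_summable_norm h1.summable.norm
      h2.summable.norm
    have h4 := summable_norm_sum_mul_antidiagonal_of_summable_norm h1.summable.norm
      h2.summable.norm
    have h5 := h4.of_norm.hasSum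
    rw [← h3, h1.tsum_eq, h2.tsum_eq] at h5
    convert! h5 using 2 with n
    rw [hcdef, Finset.sum_mul]
    refine Finset.sum_congr rfl fun kl hkl => ?_
    rw [← Finset.HasAntidiagonal.mem_antidiagonal.mp hkl, pow_add]
    ring
  have hbd := sum_sq_le_of_mul_bounded (h := fun z => h z) (lp.memℓp (coeff f)) (hasSum_coeff f) hc
    fun z => hb z z.2
  have hsum : Summable fun n => ‖c n‖ ^ 2 :=
    summable_of_sum_le (fun _ => by positivity) hbd
  have hmem : Memℓp c 2 := by
    refine memℓp_gen ?_
    simpa using hsum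
  obtain ⟨g, hg, hgc⟩ := exists_of_hasSum hmem hc
  refine ⟨g, hg, ?_⟩
  refine (sq_le_sq₀ (norm_nonneg _) (by positivity)).mp ?_
  rw [mul_pow, norm_sq_eq, norm_sq_eq, hgc]
  exact hsum.tsum_le_of_sum_le hbd

/-- Multiplication by a bounded holomorphic function is a bounded operator. -/
theorem exists_mulOp {h : ℂ → ℂ} (hh : DifferentiableOn ℂ h disc) {C : ℝ} (hC : 0 ≤ C)
    (hb : ∀ z ∈ disc, ‖h z‖ ≤ C) :
    ∃ M : Hardy →L[ℂ] Hardy, (∀ f (z : disc), (M f) z = h z * f z) ∧ ∀ f, ‖M f‖ ≤ C * ‖f‖ := by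
  choose M hM hMn using exists_mul hh hC hb
  refine ⟨LinearMap.mkContinuous ⟨⟨M, fun f g => ?_⟩, fun c f => ?_⟩ C hMn, hM, hMn⟩
  · ext z
    simp [hM, mul_add]
  · ext z
    simp [hM, mul_left_comm]

/-- A bounded holomorphic function is in the Hardy space. -/
theorem exists_of_bounded {h : ℂ → ℂ} (hh : DifferentiableOn ℂ h disc) {C : ℝ}
    (hb : ∀ z ∈ disc, ‖h z‖ ≤ C) : ∃ g : Hardy, (∀ z : disc, g z = h z) := by
  have hone : Memℓp (fun n : ℕ => if n = 0 then (1 : ℂ) else 0) 2 := by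
    refine memℓp_gen (summable_of_ne_finset_zero (s := {0}) fun n hn => ?_)
    simp_all
  obtain ⟨e, he, -⟩ := exists_of_hasSum (f := fun _ => 1) hone fun z => by
    convert hasSum_ite_eq (0 : ℕ) (1 : ℂ) using 2 with n
    split_ifs with h <;> simp [h]
  obtain ⟨g, hg, -⟩ := exists_mul hh ((norm_nonneg _).trans (hb 0 (by simp))) hb e
  exact ⟨g, fun z => by rw [hg, he, mul_one]⟩

/-- The reproducing kernel at `w`. -/
theorem exists_kernel (w : disc) : ∃ K : Hardy, (∀ f : Hardy, inner ℂ K f = f w) ∧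
    ∀ z : disc, K z = (1 - (starRingEnd ℂ) w * z)⁻¹ := by
  have hw : ‖(w : ℂ)‖ < 1 := mem_ball_zero_iff.mp w.2
  have hmem : Memℓp (fun n : ℕ => (starRingEnd ℂ) (w : ℂ) ^ n) 2 := by
    refine memℓp_gen ?_
    have := summable_geometric_of_lt_one (sq_nonneg ‖(w : ℂ)‖) (by nlinarith [norm_nonneg (w : ℂ)])
    simpa [← pow_mul, mul_comm] using this
  have hsum : ∀ z : disc, HasSum (fun n => (starRingEnd ℂ) (w : ℂ) ^ n * (z : ℂ) ^ n)
      (1 - (starRingEnd ℂ) w * z : ℂ)⁻¹ := by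
    intro z
    simp only [← mul_pow]
    refine hasSum_geometric_of_norm_lt_one ?_
    have hz : ‖(z : ℂ)‖ < 1 := mem_ball_zero_iff.mp z.2
    rw [norm_mul, RCLike.norm_conj]
    nlinarith [norm_nonneg (w : ℂ), norm_nonneg (z : ℂ)]
  obtain ⟨K, hK, hKc⟩ := exists_of_hasSum (f := fun z : disc => (1 - (starRingEnd ℂ) w * z : ℂ)⁻¹)
    hmem hsum
  refine ⟨K, fun f => ?_, hK⟩
  rw [inner_eq_tsum, hKc, ← (hasSum_coeff f w).tsum_eq]
  refine tsum_congr fun n => ?_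
  simp [mul_comm]

end Hardy

/-! ### The kernel identity -/

open ComplexConjugate

theorem one_sub_conj_mul_ne_zero {w z : ℂ} (hw : w ∈ disc) (hz : z ∈ disc) :
    1 - conj w * z ≠ 0 := by
  have hw' : ‖w‖ < 1 := mem_ball_zero_iff.mp hw
  have hz' : ‖z‖ < 1 := mem_ball_zero_iff.mp hz
  intro h
  have h1 : ‖conj w * z‖ = 1 := by rw [← sub_eq_zero.mp h, norm_one]
  rw [norm_mul, RCLike.norm_conj] at h1
  nlinarith [norm_nonneg w, norm_nonneg z]

/-- A unitary weighted composition operator transforms the reproducing kernel into itself. -/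
theorem IsWeightedComposition.kernel_identity {ψ φ : ℂ → ℂ} {hmaps : Set.MapsTo φ disc disc}
    {W : Hardy →L[ℂ] Hardy} (hW : IsWeightedComposition ψ φ hmaps W)
    (hunitary : W ∈ unitary (Hardy →L[ℂ] Hardy)) {w z : ℂ} (hw : w ∈ disc) (hz : z ∈ disc) :
    1 - conj (φ w) * φ z = ψ z * conj (ψ w) * (1 - conj w * z) := by
  choose K hK hKz using Hardy.exists_kernel
  have hadj : ∀ v : disc, star W (K v) = conj (ψ v) • K (hmaps.restrict φ disc disc v) := by
    intro v
    refine ext_inner_right ℂ fun f => ?_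
    rw [ContinuousLinearMap.star_eq_adjoint, ContinuousLinearMap.adjoint_inner_left, hK, hW,
      inner_smul_left, hK, Complex.conj_conj]
  -- `W W* = 1` makes `W*` an isometry; the reproducing property evaluates both sides.
  have h1 : inner ℂ (star W (K ⟨z, hz⟩)) (star W (K ⟨w, hw⟩)) =
      inner ℂ (K ⟨z, hz⟩) (K ⟨w, hw⟩) := by
    rw [ContinuousLinearMap.star_eq_adjoint, ContinuousLinearMap.adjoint_inner_left,
      ← mul_apply_eq_comp, ← ContinuousLinearMap.star_eq_adjoint,
      Unitary.mul_star_self_of_mem hunitary, one_apply_eq_self]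
  rw [hadj, hadj, inner_smul_left, inner_smul_right, hK, hK, hKz, hKz] at h1
  have h2 := one_sub_conj_mul_ne_zero hw hz
  have h3 := one_sub_conj_mul_ne_zero (hmaps hw) (hmaps hz)
  simp only [Set.MapsTo.val_restrict_apply, Complex.conj_conj] at h1
  field_simp at h1
  linear_combination -h1

theorem IsWeightedComposition.ne_zero {ψ φ : ℂ → ℂ} {hmaps : Set.MapsTo φ disc disc}
    {W : Hardy →L[ℂ] Hardy} (hW : IsWeightedComposition ψ φ hmaps W)
    (hunitary : W ∈ unitary (Hardy →L[ℂ] Hardy)) {z : ℂ} (hz : z ∈ disc) : ψ z ≠ 0 := by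
  intro h
  have h1 := hW.kernel_identity hunitary hz hz
  rw [h, zero_mul, zero_mul] at h1
  exact one_sub_conj_mul_ne_zero (hmaps hz) (hmaps hz) h1

/-! ### Unitary operators with a total family of eigenvectors -/

/-- A continuous function of a unitary operator acts on eigenvectors through their eigenvalue. -/
theorem cfcHom_apply_eigenvector {H : Type*} [NormedAddCommGroup H] [InnerProductSpace ℂ H]
    [CompleteSpace H] {U : H →L[ℂ] H} (hU : U ∈ unitary (H →L[ℂ] H)) (hn : IsStarNormal U)
    {e : H} {l : ℂ} (he : U e = l • e) (hl : l ∈ spectrum ℂ U) (f : C(spectrum ℂ U, ℂ)) :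
    cfcHom hn f e = f ⟨l, hl⟩ • e := by
  have hl1 : ‖l‖ = 1 := by simpa using spectrum.subset_circle_of_unitary hU hl
  have hstar : star U e = conj l • e := by
    have h1 : star U (U e) = e := by
      rw [← mul_apply_eq_comp, Unitary.star_mul_self_of_mem hU,
        one_apply_eq_self]
    rw [he, map_smul] at h1
    conv_rhs => rw [← h1]
    rw [smul_smul, Complex.conj_mul', hl1]
    simp
  have hid : cfcHom hn ((ContinuousMap.id ℂ).restrict (spectrum ℂ U)) = U := cfcHom_id hn
  refine ContinuousMap.induction_on_of_compact ?_ ?_ ?_ ?_ ?_ ?_ f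
  · intro c
    have : ContinuousMap.const (spectrum ℂ U) c = algebraMap ℂ _ c := rfl
    rw [this, AlgHomClass.commutes]
    simp [Algebra.algebraMap_eq_smul_one]
  · rw [hid]
    exact he
  · rw [map_star, hid]
    exact hstar
  · intro f g hf hg
    rw [map_add, add_apply, hf, hg, ContinuousMap.add_apply, add_smul]
  · intro f g hf hg
    rw [map_mul, mul_apply_eq_comp, hg, map_smul, hf, ContinuousMap.mul_apply,
      smul_smul, mul_comm]
  · intro f hf
    have hc : IsClosed {g : C(spectrum ℂ U, ℂ) | cfcHom hn g e = g ⟨l, hl⟩ • e} := by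
      refine isClosed_eq ?_ ?_
      · exact (ContinuousLinearMap.apply ℂ H e).continuous.comp (cfcHom_continuous hn)
      · exact (continuous_eval_const (⟨l, hl⟩ : spectrum ℂ U)).smul continuous_const
    exact hc.closure_subset (mem_closure_iff_frequently.mpr hf)

/-- The spectrum of a unitary operator with a total sequence of eigenvectors is the closure of the
set of eigenvalues. -/
theorem spectrum_eq_closure_of_eigenvectors {H : Type*} [NormedAddCommGroup H]
    [InnerProductSpace ℂ H] [CompleteSpace H] {U : H →L[ℂ] H} (hU : U ∈ unitary (H →L[ℂ] H))
    {ι : Type*} [Nonempty ι] {e : ι → H} {l : ι → ℂ} (he : ∀ i, U (e i) = l i • e i) (hne : ∀ i, e i ≠ 0)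
    (htotal : ∀ A : H →L[ℂ] H, (∀ i, A (e i) = 0) → A = 0) :
    spectrum ℂ U = closure (Set.range l) := by
  have hn : IsStarNormal U :=
    ⟨by rw [Commute, SemiconjBy, Unitary.star_mul_self_of_mem hU, Unitary.mul_star_self_of_mem hU]⟩
  have hmem : ∀ i, l i ∈ spectrum ℂ U := by
    intro i
    rw [spectrum.mem_iff]
    intro hunit
    obtain ⟨V, hV⟩ := hunit.exists_left_inv
    have := congrArg (fun A : H →L[ℂ] H => A (e i)) hV
    simp [Algebra.algebraMap_eq_smul_one, he] at this
    exact hne i this.symm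
  refine Set.Subset.antisymm (fun x hx => ?_)
    (closure_minimal (Set.range_subset_iff.mpr hmem) (spectrum.isClosed U))
  by_contra hxc
  -- The distance to the closed set of eigenvalues vanishes at each of them, so `f(U)` kills a total
  -- family. Injectivity of the calculus then forces `f = 0`, although `f x ≠ 0`.
  let f : C(spectrum ℂ U, ℂ) := ⟨fun y => (infDist (y : ℂ) (closure (Set.range l)) : ℂ), by fun_prop⟩
  have h0 : cfcHom hn f = 0 := by
    refine htotal _ fun i => ?_
    rw [cfcHom_apply_eigenvector hU hn (he i) (hmem i)]
    have : f ⟨l i, hmem i⟩ = 0 := by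
      simp [f, infDist_zero_of_mem (subset_closure (Set.mem_range_self i))]
    rw [this, zero_smul]
  have hf0 : f = 0 := cfcHom_injective hn (by rw [h0, map_zero])
  have hfx := congrArg (fun g : C(spectrum ℂ U, ℂ) => g ⟨x, hx⟩) hf0
  have h5 : infDist x (closure (Set.range l)) = 0 := by
    simpa [f] using hfx
  exact hxc ((isClosed_closure.mem_iff_infDist_zero (Set.range_nonempty l).closure).mpr h5)

/-! ### Symbols with a fixed point in the disc -/

/-- The automorphism of the disc that exchanges `p` and `0`. -/
noncomputable def blaschke (p z : ℂ) : ℂ := (p - z) / (1 - conj p * z)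

/-- The automorphism changes `1 - conj w * z` only by a constant, a factor in `z` and a factor in
`w`. The last two have the form of the factors by which the weight enters the kernel identity. -/
theorem one_sub_conj_blaschke_mul {p w z : ℂ} (hp : p ∈ disc) (hw : w ∈ disc) (hz : z ∈ disc) :
    1 - conj (blaschke p w) * blaschke p z =
      (1 - conj p * p) * (1 - conj w * z) / ((1 - conj p * z) * (1 - conj w * p)) := by
  have h1 := one_sub_conj_mul_ne_zero hp hz
  have h2 := one_sub_conj_mul_ne_zero hw hp
  have h3 : 1 - p * conj w ≠ 0 := by rwa [mul_comm]
  simp only [blaschke, map_div₀, map_sub, map_mul, map_one, Complex.conj_conj]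
  field_simp
  ring

theorem norm_blaschke_lt {p z : ℂ} (hp : p ∈ disc) (hz : z ∈ disc) : ‖blaschke p z‖ < 1 := by
  have hp' : ‖p‖ < 1 := mem_ball_zero_iff.mp hp
  have hz' : ‖z‖ < 1 := mem_ball_zero_iff.mp hz
  have h := one_sub_conj_blaschke_mul hp hz hz
  have h1 := one_sub_conj_mul_ne_zero hp hz
  rw [Complex.conj_mul', Complex.conj_mul', Complex.conj_mul',
    show (1 - conj z * p) = conj (1 - conj p * z) by simp [mul_comm], Complex.mul_conj'] at h
  have h2 : 1 - ‖blaschke p z‖ ^ 2 = (1 - ‖p‖ ^ 2) * (1 - ‖z‖ ^ 2) / ‖1 - conj p * z‖ ^ 2 := by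
    exact_mod_cast h
  have h3 : 0 < 1 - ‖p‖ ^ 2 := by nlinarith [norm_nonneg p]
  have h4 : 0 < 1 - ‖z‖ ^ 2 := by nlinarith [norm_nonneg z]
  have h5 : 0 < ‖1 - conj p * z‖ := norm_pos_iff.mpr h1
  have h6 : 0 < 1 - ‖blaschke p z‖ ^ 2 := by rw [h2]; positivity
  nlinarith [norm_nonneg (blaschke p z)]

theorem hasDerivAt_blaschke {p z : ℂ} (hp : p ∈ disc) (hz : z ∈ disc) :
    HasDerivAt (blaschke p) ((conj p * p - 1) / (1 - conj p * z) ^ 2) z := by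
  have h1 := one_sub_conj_mul_ne_zero hp hz
  have := ((hasDerivAt_id z).const_sub p).fun_div
    (((hasDerivAt_id z).const_mul (conj p)).const_sub 1) h1
  convert! this using 1
  simp only [id]
  field_simp
  ring

theorem differentiableOn_blaschke {p : ℂ} (hp : p ∈ disc) :
    DifferentiableOn ℂ (blaschke p) disc := fun _ hz =>
  (hasDerivAt_blaschke hp hz).differentiableAt.differentiableWithinAt

theorem blaschke_ne_zero {p z : ℂ} (hp : p ∈ disc) (hz : z ∈ disc) (h : z ≠ p) :
    blaschke p z ≠ 0 :=
  div_ne_zero (sub_ne_zero.mpr h.symm) (one_sub_conj_mul_ne_zero hp hz)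

theorem exists_mem_disc_ne (p : ℂ) : ∃ w ∈ disc, w ≠ p := by
  by_cases h : p = 0
  · exact ⟨1 / 2, by norm_num [mem_ball_zero_iff], by simp [h]⟩
  · exact ⟨0, by simp, fun h' => h h'.symm⟩

/-- A bounded operator on `H²` that annihilates all functions `b_pⁿ k_p` is zero. -/
theorem eq_zero_of_annihilates {p : ℂ} (hp : p ∈ disc) {e : ℕ → Hardy} {C : ℝ}
    (he : ∀ n (z : disc), e n z = blaschke p z ^ n * (1 - conj p * z)⁻¹)
    (hb : ∀ n, ‖e n‖ ≤ C) (A : Hardy →L[ℂ] Hardy) (hA : ∀ n, A (e n) = 0) : A = 0 := by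
  choose K hK hKz using Hardy.exists_kernel
  have hAK : ∀ w : disc, A (K w) = 0 := by
    intro w
    -- Solving `one_sub_conj_blaschke_mul` for `K_w(z)` leaves this constant times `K_p(z) / (1 -
    -- conj (b w) b(z))`, with `b = blaschke p`; the geometric series gives the coefficients.
    set c : ℂ := (1 - conj p * p) / (1 - conj (w : ℂ) * p) with hc
    have hs : Summable fun n => (c * conj (blaschke p w) ^ n) • e n := by
      refine Summable.of_norm_bounded
        (((summable_geometric_of_lt_one (norm_nonneg _) (norm_blaschke_lt hp w.2)).mul_left
          ‖c‖).mul_right C) fun n => ?_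
      rw [norm_smul, norm_mul, norm_pow, RCLike.norm_conj]
      gcongr
      exact hb n
    have hsum : HasSum (fun n => (c * conj (blaschke p w) ^ n) • e n) (K w) := by
      have h1 := hs.hasSum
      have h2 : ∑' n, (c * conj (blaschke p w) ^ n) • e n = K w := by
        ext z
        have h3 := h1.mapL (innerSL ℂ (K z))
        simp only [innerSL_apply_apply, hK, Hardy.smul_apply, he] at h3
        have h4 : ‖conj (blaschke p w) * blaschke p z‖ < 1 := by
          rw [norm_mul, RCLike.norm_conj]
          nlinarith [norm_blaschke_lt hp w.2, norm_blaschke_lt hp z.2,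
            norm_nonneg (blaschke p w), norm_nonneg (blaschke p z)]
        have h5 := ((hasSum_geometric_of_norm_lt_one h4).mul_left c).mul_right
          (1 - conj p * (z : ℂ))⁻¹
        have h6 : (fun n => c * conj (blaschke p w) ^ n * (blaschke p z ^ n * (1 - conj p * z)⁻¹)) =
            fun n => c * (conj (blaschke p w) * blaschke p z) ^ n * (1 - conj p * (z : ℂ))⁻¹ := by
          ext n
          rw [mul_pow]
          ring
        rw [h6] at h3
        rw [h3.unique h5, hKz, one_sub_conj_blaschke_mul hp w.2 z.2, hc]
        have h7 := one_sub_conj_mul_ne_zero hp z.2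
        have h8 := one_sub_conj_mul_ne_zero w.2 hp
        have h9 := one_sub_conj_mul_ne_zero hp hp
        have h10 := one_sub_conj_mul_ne_zero w.2 z.2
        rw [mul_inv_eq_iff_eq_mul₀ h7, div_mul_eq_mul_div, div_eq_iff h8]
        field_simp
      rwa [h2] at h1
    have h := hsum.mapL A
    simp only [map_smul, hA, smul_zero] at h
    exact h.unique hasSum_zero
  -- The value of `A* g` at `w` is `⟨A K_w, g⟩`, which is zero.
  have hstar : star A = 0 := by
    ext g w
    rw [← hK, ContinuousLinearMap.star_eq_adjoint, ContinuousLinearMap.adjoint_inner_right, hAK,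
      inner_zero_left]
    rfl
  simpa using congrArg star hstar

section FixedPoint

variable {ψ φ : ℂ → ℂ} {hmaps : Set.MapsTo φ disc disc} {W : Hardy →L[ℂ] Hardy} {p : ℂ}

theorem IsWeightedComposition.conj_mul_self_of_fixed (hW : IsWeightedComposition ψ φ hmaps W)
    (hunitary : W ∈ unitary (Hardy →L[ℂ] Hardy)) (hp : p ∈ disc) (hfix : φ p = p) :
    ψ p * conj (ψ p) = 1 := by
  have h := hW.kernel_identity hunitary hp hp
  rw [hfix] at h
  exact mul_right_cancel₀ (one_sub_conj_mul_ne_zero hp hp) (by rw [← h, one_mul])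

/-- The kernel identities at `(p, z)`, `(w, p)` and `(w, z)` combine so that the weights cancel,
using `|ψ(p)| = 1`. -/
theorem IsWeightedComposition.conj_blaschke_comp_mul (hW : IsWeightedComposition ψ φ hmaps W)
    (hunitary : W ∈ unitary (Hardy →L[ℂ] Hardy)) (hp : p ∈ disc) (hfix : φ p = p) {w z : ℂ}
    (hw : w ∈ disc) (hz : z ∈ disc) :
    conj (blaschke p (φ w)) * blaschke p (φ z) = conj (blaschke p w) * blaschke p z := by
  have h1 := hW.kernel_identity hunitary hp hz
  have h2 := hW.kernel_identity hunitary hw hp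
  have h3 := hW.kernel_identity hunitary hw hz
  have h4 := hW.conj_mul_self_of_fixed hunitary hp hfix
  rw [hfix] at h1 h2
  have h5 := one_sub_conj_blaschke_mul hp (hmaps hw) (hmaps hz)
  have h6 := one_sub_conj_blaschke_mul hp hw hz
  have hz0 := hW.ne_zero hunitary hz
  have hw0 : conj (ψ w) ≠ 0 := by simpa using hW.ne_zero hunitary hw
  have h7 := one_sub_conj_mul_ne_zero hp hz
  have h8 := one_sub_conj_mul_ne_zero hw hp
  have h9 : (1 - conj p * φ z) * (1 - conj (φ w) * p) =
      ψ z * conj (ψ w) * ((1 - conj p * z) * (1 - conj w * p)) := by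
    rw [h1, h2]
    linear_combination ψ z * conj (ψ w) * (1 - conj p * z) * (1 - conj w * p) * h4
  rw [h9, h3] at h5
  have h10 : 1 - conj (blaschke p (φ w)) * blaschke p (φ z) =
      1 - conj (blaschke p w) * blaschke p z := by
    rw [h5, h6]
    field_simp
  linear_combination -h10

/-- Freezing `w ≠ p` in `conj_blaschke_comp_mul` makes `b ∘ φ` a constant multiple of `b`. The case
`z = w` shows that the constant is unimodular, and differentiating at `p`, where `b' ≠ 0`,
identifies it as `φ'(p)`. -/
theorem IsWeightedComposition.blaschke_comp (hW : IsWeightedComposition ψ φ hmaps W)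
    (hunitary : W ∈ unitary (Hardy →L[ℂ] Hardy)) (hφ : DifferentiableOn ℂ φ disc)
    (hp : p ∈ disc) (hfix : φ p = p) :
    ‖deriv φ p‖ = 1 ∧ ∀ z ∈ disc, blaschke p (φ z) = deriv φ p * blaschke p z := by
  obtain ⟨w, hw, hwp⟩ := exists_mem_disc_ne p
  have hbw := blaschke_ne_zero hp hw hwp
  have hid := fun {z} (hz : z ∈ disc) => hW.conj_blaschke_comp_mul hunitary hp hfix hw hz
  have hnorm : ‖blaschke p (φ w)‖ = ‖blaschke p w‖ := by
    have h := congrArg norm (hid hw)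
    simp only [norm_mul, RCLike.norm_conj, ← sq] at h
    exact (sq_eq_sq₀ (norm_nonneg _) (norm_nonneg _)).mp h
  have hbφ : conj (blaschke p (φ w)) ≠ 0 := by
    rw [← norm_ne_zero_iff, RCLike.norm_conj, hnorm]
    exact norm_ne_zero_iff.mpr hbw
  set μ : ℂ := conj (blaschke p w) / conj (blaschke p (φ w)) with hμ
  have hcomp : ∀ z ∈ disc, blaschke p (φ z) = μ * blaschke p z := by
    intro z hz
    rw [hμ, div_mul_eq_mul_div, eq_div_iff hbφ, mul_comm, hid hz]
  have hμn : ‖μ‖ = 1 := by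
    rw [hμ, norm_div, RCLike.norm_conj, RCLike.norm_conj, hnorm]
    exact div_self (norm_ne_zero_iff.mpr hbw)
  have hnhds : disc ∈ 𝓝 p := isOpen_ball.mem_nhds hp
  have hφd : HasDerivAt φ (deriv φ p) p := (hφ.differentiableAt hnhds).hasDerivAt
  have hb := hasDerivAt_blaschke hp hp
  have hd1 := HasDerivAt.comp p (by rwa [hfix]) hφd (h₂ := blaschke p)
  have hd2 : HasDerivAt (blaschke p ∘ φ) _ p := (hb.const_mul μ).congr_of_eventuallyEq
    (by filter_upwards [hnhds] with z hz using hcomp z hz)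
  have hne : (conj p * p - 1) / (1 - conj p * p) ^ 2 ≠ 0 := by
    have := one_sub_conj_mul_ne_zero hp hp
    refine div_ne_zero (fun h => this ?_) (pow_ne_zero 2 this)
    linear_combination -h
  have hμd : deriv φ p = μ := by
    refine mul_left_cancel₀ hne ((hd1.unique hd2).trans (mul_comm _ _))
  rw [hμd]
  exact ⟨hμn, hcomp⟩

/-- The spectrum of a unitary weighted composition operator whose symbol has a fixed point. -/
theorem IsWeightedComposition.spectrum_of_fixed (hW : IsWeightedComposition ψ φ hmaps W)
    (hunitary : W ∈ unitary (Hardy →L[ℂ] Hardy)) (hφ : DifferentiableOn ℂ φ disc)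
    (hp : p ∈ disc) (hfix : φ p = p) :
    spectrum ℂ W = closure (Set.range fun n : ℕ => ψ p * deriv φ p ^ n) := by
  obtain ⟨-, hcomp⟩ := hW.blaschke_comp hunitary hφ hp hfix
  obtain ⟨M, hM, hMn⟩ := Hardy.exists_mulOp (differentiableOn_blaschke hp) zero_le_one
    fun z hz => (norm_blaschke_lt hp hz).le
  obtain ⟨K, -, hKz⟩ := Hardy.exists_kernel ⟨p, hp⟩
  let e : ℕ → Hardy := fun n => (M ^ n) K
  have hsucc : ∀ n, e (n + 1) = M (e n) := fun n => by
    simp only [e, pow_succ', mul_apply_eq_comp]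
  have he : ∀ n (z : disc), e n z = blaschke p z ^ n * (1 - conj p * z)⁻¹ := by
    intro n z
    induction n with
    | zero => simpa [e] using hKz z
    | succ n ih => rw [hsucc, hM, ih]; ring
  have hb : ∀ n, ‖e n‖ ≤ ‖K‖ := by
    intro n
    induction n with
    | zero => simp [e]
    | succ n ih =>
      rw [hsucc]
      exact (hMn _).trans (by rwa [one_mul])
  refine spectrum_eq_closure_of_eigenvectors hunitary (e := e) (fun n => ?_) (fun n hn => ?_)
    (eq_zero_of_annihilates hp he hb)
  · ext z
    -- With `w = p` the identity says `ψ · (K_p ∘ φ) = ψ(p) K_p`; each factor `b` then contributes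
    -- one `φ'(p)`.
    have h1 := hW.kernel_identity hunitary hp z.2
    have h2 := hW.conj_mul_self_of_fixed hunitary hp hfix
    rw [hfix] at h1
    have h3 := hW.ne_zero hunitary z.2
    have h4 := one_sub_conj_mul_ne_zero hp z.2
    have h5 : conj (ψ p) ≠ 0 := right_ne_zero_of_mul_eq_one h2
    rw [hW, Hardy.smul_apply, he, he, Set.MapsTo.val_restrict_apply, hcomp z z.2, h1]
    field_simp
    linear_combination -(deriv φ p * blaschke p z) ^ n * h2
  · obtain ⟨w, hw, hwp⟩ := exists_mem_disc_ne p
    have h := he n ⟨w, hw⟩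
    rw [hn] at h
    exact mul_ne_zero (pow_ne_zero n (blaschke_ne_zero hp hw hwp))
      (inv_ne_zero (one_sub_conj_mul_ne_zero hp hw)) h.symm

end FixedPoint

/-! ### The half-plane model -/

/-- The Cayley transform, which maps the disc onto the right half-plane and `ω` to infinity. -/
noncomputable def cayley (ω z : ℂ) : ℂ := (ω + z) / (ω - z)

section Cayley

variable {ω : ℂ}

theorem sub_ne_zero_of_mem_disc (hω : ‖ω‖ = 1) {z : ℂ} (hz : z ∈ disc) : ω - z ≠ 0 := by
  have hz' : ‖z‖ < 1 := mem_ball_zero_iff.mp hz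
  intro h
  rw [← sub_eq_zero.mp h, hω] at hz'
  exact lt_irrefl _ hz'

/-- Up to a factor in `z` and a factor in `w`, `1 - conj w * z` becomes the half-plane expression `Z
+ conj W`, so the kernel identity can be read in the coordinate `cayley ω`. -/
theorem cayley_add_conj (hω : ‖ω‖ = 1) {w z : ℂ} (hw : w ∈ disc) (hz : z ∈ disc) :
    cayley ω z + conj (cayley ω w) = 2 * (1 - conj w * z) / ((ω - z) * conj (ω - w)) := by
  have h1 := sub_ne_zero_of_mem_disc hω hz
  have h2 : conj (ω - w) ≠ 0 :=
      (map_ne_zero (starRingEnd ℂ)).mpr (sub_ne_zero_of_mem_disc hω hw)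
  have h3 : ω * conj ω = 1 := by rw [Complex.mul_conj', hω]; simp
  rw [cayley, cayley, map_div₀, div_add_div _ _ h1 h2]
  congr 1
  simp only [map_add, map_sub]
  linear_combination 2 * h3

theorem cayley_add_one (hω : ‖ω‖ = 1) {z : ℂ} (hz : z ∈ disc) :
    cayley ω z + 1 = 2 * ω / (ω - z) := by
  have h1 := sub_ne_zero_of_mem_disc hω hz
  rw [cayley]
  field_simp
  ring

theorem cayley_re_pos (hω : ‖ω‖ = 1) {z : ℂ} (hz : z ∈ disc) : 0 < (cayley ω z).re := by
  have h := cayley_add_conj hω hz hz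
  rw [Complex.add_conj, Complex.conj_mul', Complex.mul_conj'] at h
  have h1 : 2 * (cayley ω z).re = 2 * (1 - ‖z‖ ^ 2) / ‖ω - z‖ ^ 2 := by exact_mod_cast h
  have h2 : 0 < ‖ω - z‖ := norm_pos_iff.mpr (sub_ne_zero_of_mem_disc hω hz)
  have hz' : ‖z‖ < 1 := mem_ball_zero_iff.mp hz
  have h3 : 0 < 1 - ‖z‖ ^ 2 := by nlinarith [norm_nonneg z]
  have h4 : 0 < 2 * (cayley ω z).re := by rw [h1]; positivity
  linarith

theorem differentiableOn_cayley (hω : ‖ω‖ = 1) : DifferentiableOn ℂ (cayley ω) disc := by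
  unfold cayley
  exact DifferentiableOn.fun_div (by fun_prop) (by fun_prop) fun z hz =>
    sub_ne_zero_of_mem_disc hω hz

theorem cayley_zero (hω : ‖ω‖ = 1) : cayley ω 0 = 1 := by
  have : ω ≠ 0 := by rw [← norm_ne_zero_iff, hω]; exact one_ne_zero
  simp [cayley, this]

theorem cayley_injOn (hω : ‖ω‖ = 1) : Set.InjOn (cayley ω) disc := by
  intro z hz w hw h
  have h1 := cayley_add_one hω hz
  have h2 := sub_ne_zero_of_mem_disc hω hz
  have h3 := sub_ne_zero_of_mem_disc hω hw
  have h0 : ω ≠ 0 := by rw [← norm_ne_zero_iff, hω]; exact one_ne_zero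
  rw [h, cayley_add_one hω hw, div_eq_div_iff h3 h2] at h1
  have h4 := mul_left_cancel₀ (mul_ne_zero two_ne_zero h0) h1
  linear_combination -h4

end Cayley

/-! ### Symbols with a Denjoy-Wolff point on the circle: affine form and rotation of the spectrum -/

section BoundaryPoint

variable {ψ φ : ℂ → ℂ} {hmaps : Set.MapsTo φ disc disc} {W : Hardy →L[ℂ] Hardy} {ω : ℂ}

/-- This is the limit of the kernel identity as `w` runs through the orbit of `0`, which tends to
`ω`; multiplying by `ω` clears `conj ω`. -/
theorem IsWeightedComposition.exists_boundary_cocycle (hW : IsWeightedComposition ψ φ hmaps W)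
    (hunitary : W ∈ unitary (Hardy →L[ℂ] Hardy)) (hω : ‖ω‖ = 1) (hDW : IsDenjoyWolffPoint φ ω) :
    ∃ η : ℂ, η ≠ 0 ∧ ∀ z ∈ disc, ω - φ z = η * ψ z * (ω - z) := by
  have h0 : (0 : ℂ) ∈ disc := by simp
  have hmem : ∀ n, φ^[n] 0 ∈ disc := fun n => hmaps.iterate n h0
  have hlim := hDW 0 h0
  have hlim1 : Tendsto (fun n => conj (φ^[n] 0)) atTop (𝓝 (conj ω)) :=
    (Complex.continuous_conj.tendsto ω).comp hlim
  have hlim2 := (tendsto_add_atTop_iff_nat 1).mpr hlim1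
  have hid : ∀ n, ∀ z ∈ disc, 1 - conj (φ^[n + 1] 0) * φ z =
      ψ z * conj (ψ (φ^[n] 0)) * (1 - conj (φ^[n] 0) * z) := by
    intro n z hz
    rw [Function.iterate_succ_apply']
    exact hW.kernel_identity hunitary (hmem n) hz
  have hψ0 := hW.ne_zero hunitary h0
  -- The weights along the orbit converge because the identity at `z = 0`, where `1 - conj w * z =
  -- 1`, can be solved for them.
  have hη : Tendsto (fun n => conj (ψ (φ^[n] 0))) atTop (𝓝 ((1 - conj ω * φ 0) / ψ 0)) := by
    refine (((hlim2.mul_const (φ 0)).const_sub 1).div_const (ψ 0)).congr fun n => ?_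
    rw [hid n 0 h0]
    field_simp
    simp
  have h3 : ω * conj ω = 1 := by rw [Complex.mul_conj', hω]; simp
  set η := (1 - conj ω * φ 0) / ψ 0
  have hcoc : ∀ z ∈ disc, ω - φ z = η * ψ z * (ω - z) := by
    intro z hz
    have h1 := (hlim2.mul_const (φ z)).const_sub 1
    have h2 := ((hη.const_mul (ψ z)).mul ((hlim1.mul_const z).const_sub 1))
    have h4 := tendsto_nhds_unique h1 (h2.congr fun n => (hid n z hz).symm)
    linear_combination ω * h4 + (φ z - ψ z * η * z) * h3
  refine ⟨η, fun h => ?_, hcoc⟩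
  have h5 := hcoc 0 h0
  rw [h, zero_mul, zero_mul] at h5
  exact sub_ne_zero_of_mem_disc hω (hmaps h0) h5

/-- In the half-plane model the symbol is affine. -/
theorem IsWeightedComposition.cayley_comp (hW : IsWeightedComposition ψ φ hmaps W)
    (hunitary : W ∈ unitary (Hardy →L[ℂ] Hardy)) (hω : ‖ω‖ = 1) {η : ℂ} (hη : η ≠ 0)
    (hcoc : ∀ z ∈ disc, ω - φ z = η * ψ z * (ω - z)) {r : ℝ} (hr : r = (‖η‖ ^ 2)⁻¹) :
    ∃ c : ℝ, ∀ z ∈ disc, cayley ω (φ z) = r * cayley ω z + c * Complex.I := by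
  have h0 : (0 : ℂ) ∈ disc := by simp
  have hrel : ∀ z ∈ disc, ∀ w ∈ disc, cayley ω (φ z) + conj (cayley ω (φ w)) =
      r * (cayley ω z + conj (cayley ω w)) := by
    intro z hz w hw
    rw [cayley_add_conj hω (hmaps hw) (hmaps hz), cayley_add_conj hω hw hz,
      hW.kernel_identity hunitary hw hz, hcoc z hz, hcoc w hw]
    have h1 := sub_ne_zero_of_mem_disc hω hz
    have h2 : conj (ω - w) ≠ 0 :=
      (map_ne_zero (starRingEnd ℂ)).mpr (sub_ne_zero_of_mem_disc hω hw)
    have h3 := hW.ne_zero hunitary hz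
    have h4 : conj (ψ w) ≠ 0 := by simpa using hW.ne_zero hunitary hw
    have h5 : conj η ≠ 0 := by simpa using hη
    have h6 : (r : ℂ) = (η * conj η)⁻¹ := by rw [hr, Complex.mul_conj']; push_cast; rfl
    rw [map_mul, map_mul, h6]
    field_simp
  -- Since `cayley ω 0 = 1`, the relation at `z = w = 0` gives real part `r` to `cayley ω (φ 0)`;
  -- only its imaginary part remains as translation.
  refine ⟨(cayley ω (φ 0)).im, fun z hz => ?_⟩
  have h1 := hrel z hz 0 h0
  have h2 := hrel 0 h0 0 h0
  rw [cayley_zero hω, map_one, Complex.add_conj] at h2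
  rw [cayley_zero hω, map_one] at h1
  have h3 := Complex.sub_conj (cayley ω (φ 0))
  have h4 := Complex.add_conj (cayley ω (φ 0))
  push_cast at h2 h3 h4
  linear_combination h1 - h4 / 2 - h2 / 2 + h3 / 2

/-- The spectrum is invariant under rotation by the eigenvalue of a multiplier that is bounded and
bounded away from zero. -/
theorem IsWeightedComposition.mul_mem_spectrum (hW : IsWeightedComposition ψ φ hmaps W)
    {u v : ℂ → ℂ} (hu : DifferentiableOn ℂ u disc) (hv : DifferentiableOn ℂ v disc) {B : ℝ}
    (hB : 0 ≤ B) (hub : ∀ z ∈ disc, ‖u z‖ ≤ B) (hvb : ∀ z ∈ disc, ‖v z‖ ≤ B)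
    (huv : ∀ z ∈ disc, u z * v z = 1) {a : ℂ} (ha : a ≠ 0) (hcomp : ∀ z ∈ disc, u (φ z) = a * u z)
    {l : ℂ} (hl : l ∈ spectrum ℂ W) : a * l ∈ spectrum ℂ W := by
  obtain ⟨U, hU, -⟩ := Hardy.exists_mulOp hu hB hub
  obtain ⟨V, hV, -⟩ := Hardy.exists_mulOp hv hB hvb
  let E : (Hardy →L[ℂ] Hardy)ˣ := ⟨U, V, by
    ext f z
    change U (V f) z = f z
    rw [hU, hV]
    linear_combination f z * huv z z.2, by
    ext f z
    change V (U f) z = f z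
    rw [hV, hU]
    linear_combination f z * huv z z.2⟩
  -- Moving multiplication by `u` past `W` costs the factor `a`, so `W` is similar to `a • W`.
  have h1 : (E⁻¹ : (Hardy →L[ℂ] Hardy)ˣ) * W * (E : Hardy →L[ℂ] Hardy) = Units.mk0 a ha • W := by
    ext f z
    change V (W (U f)) z = (a • W f) z
    rw [hV, hW, hU, Hardy.smul_apply, hW, Set.MapsTo.val_restrict_apply, hcomp z z.2]
    linear_combination a * ψ z * f (hmaps.restrict φ disc disc z) * huv z z.2
  have h2 := spectrum.units_conjugate' (R := ℂ) (a := W) (u := E)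
  rw [h1, spectrum.unit_smul_eq_smul] at h2
  rw [← h2]
  exact Set.smul_mem_smul_set hl

end BoundaryPoint

/-! ### Dilations and translations of the half-plane -/

section BoundaryPoint

variable {ψ φ : ℂ → ℂ} {hmaps : Set.MapsTo φ disc disc} {W : Hardy →L[ℂ] Hardy} {ω : ℂ}

/-- In the hyperbolic case, imaginary powers of the half-plane coordinate are eigenvectors of
composition with the symbol. -/
theorem exists_power_multiplier (hω : ‖ω‖ = 1) {r c : ℝ} (hr : 0 < r) (hr1 : r ≠ 1)
    (h : ∀ z ∈ disc, cayley ω (φ z) = r * cayley ω z + c * Complex.I) (t : ℝ) :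
    ∃ u v : ℂ → ℂ, DifferentiableOn ℂ u disc ∧ DifferentiableOn ℂ v disc ∧
      (∃ B, 0 ≤ B ∧ (∀ z ∈ disc, ‖u z‖ ≤ B) ∧ ∀ z ∈ disc, ‖v z‖ ≤ B) ∧
      (∀ z ∈ disc, u z * v z = 1) ∧
      ∀ z ∈ disc, u (φ z) = Complex.exp ((t * Real.log r : ℝ) * Complex.I) * u z := by
  -- The shift moves the fixed point of `Z ↦ r Z + i c` to `0`, so that `g ∘ φ = r g`. As `Re g >
  -- 0`, the principal logarithm is holomorphic, and bounded arguments keep `g^{± i t}` bounded.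
  set g : ℂ → ℂ := fun z => cayley ω z + ((c / (r - 1) : ℝ) : ℂ) * Complex.I with hg
  have hre : ∀ z ∈ disc, 0 < (g z).re := by
    intro z hz
    simpa only [hg, Complex.add_re, Complex.re_ofReal_mul, Complex.I_re, mul_zero, add_zero] using
      cayley_re_pos hω hz
  have hgd : DifferentiableOn ℂ g disc := (differentiableOn_cayley hω).add_const _
  have hlog : DifferentiableOn ℂ (fun z => Complex.log (g z)) disc :=
    hgd.clog fun z hz => Or.inl (hre z hz)
  have hr1' : (r : ℂ) - 1 ≠ 0 := by
    have : r - 1 ≠ 0 := sub_ne_zero.mpr hr1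
    exact_mod_cast this
  have hcomp : ∀ z ∈ disc, g (φ z) = r * g z := by
    intro z hz
    simp only [hg]
    rw [h z hz]
    push_cast
    field_simp
    ring
  have hbd : ∀ s : ℝ, ∀ z, ‖Complex.exp (s * Complex.I * Complex.log (g z))‖ ≤
      Real.exp (|s| * Real.pi) := by
    intro s z
    rw [Complex.norm_exp, Real.exp_le_exp]
    have h1 : (s * Complex.I * Complex.log (g z)).re = -(s * (g z).arg) := by
      simp [Complex.mul_re, Complex.mul_im, Complex.log_im]
    rw [h1]
    calc -(s * (g z).arg) ≤ |s * (g z).arg| := neg_le_abs _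
      _ = |s| * |(g z).arg| := abs_mul _ _
      _ ≤ |s| * Real.pi := by gcongr; exact Complex.abs_arg_le_pi _
  refine ⟨fun z => Complex.exp (t * Complex.I * Complex.log (g z)),
    fun z => Complex.exp ((-t : ℝ) * Complex.I * Complex.log (g z)),
    (hlog.const_mul _).cexp, (hlog.const_mul _).cexp,
    ⟨Real.exp (|t| * Real.pi), (Real.exp_pos _).le, fun z _ => hbd t z, fun z _ => ?_⟩,
    fun z _ => ?_, fun z hz => ?_⟩
  · simpa using hbd (-t) z
  · rw [← Complex.exp_add, ← Complex.exp_zero]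
    congr 1
    push_cast
    ring
  · have hne : g z ≠ 0 := fun h0 => by
      have := hre z hz
      rw [h0] at this
      exact lt_irrefl _ this
    simp only []
    rw [hcomp z hz, Complex.log_ofReal_mul hr hne, ← Complex.exp_add]
    congr 1
    push_cast
    ring

/-- The spectrum is a nonempty subset of the circle, invariant under multiplication by every `r^{i
t}`; these numbers fill the circle because `log r ≠ 0`. -/
theorem IsWeightedComposition.spectrum_of_dilation (hW : IsWeightedComposition ψ φ hmaps W)
    (hunitary : W ∈ unitary (Hardy →L[ℂ] Hardy)) (hω : ‖ω‖ = 1) {r c : ℝ} (hr : 0 < r)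
    (hr1 : r ≠ 1) (h : ∀ z ∈ disc, cayley ω (φ z) = r * cayley ω z + c * Complex.I) :
    spectrum ℂ W = sphere (0 : ℂ) 1 := by
  obtain ⟨K, -, hK⟩ := Hardy.exists_kernel ⟨0, by simp⟩
  have : Nontrivial Hardy := by
    refine ⟨K, 0, fun h0 => ?_⟩
    have h1 := hK ⟨0, by simp⟩
    rw [h0] at h1
    rw [Hardy.zero_apply] at h1
    simp at h1
  refine Set.Subset.antisymm (spectrum.subset_circle_of_unitary hunitary) fun l hl => ?_
  obtain ⟨l₀, hl₀⟩ := spectrum.nonempty W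
  have h1 : ‖l₀‖ = 1 := by simpa using spectrum.subset_circle_of_unitary hunitary hl₀
  have h2 : ‖l‖ = 1 := by simpa using hl
  have hl₀0 : l₀ ≠ 0 := by rw [← norm_ne_zero_iff, h1]; exact one_ne_zero
  have hlog : Real.log r ≠ 0 := Real.log_ne_zero_of_pos_of_ne_one hr hr1
  -- This exponent makes the rotation factor equal to `l / l₀`.
  obtain ⟨u, v, hu, hv, ⟨B, hB, hub, hvb⟩, huv, hcomp⟩ :=
    exists_power_multiplier hω hr hr1 h ((l / l₀).arg / Real.log r)
  have h3 := hW.mul_mem_spectrum hu hv hB hub hvb huv (Complex.exp_ne_zero _) hcomp hl₀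
  have h4 := Complex.norm_mul_exp_arg_mul_I (l / l₀)
  rw [norm_div, h1, h2, div_one, Complex.ofReal_one, one_mul] at h4
  rw [div_mul_cancel₀ _ hlog, h4, div_mul_cancel₀ _ hl₀0] at h3
  exact h3

/-- An element of the Hardy space on which a weighted composition operator acts as a multiplier
close to the constant `l` is an approximate eigenvector. -/
theorem mem_spectrum_of_approx {l : ℂ} {D : ℝ}
    (happ : ∀ R : ℝ, 1 ≤ R → ∃ f : Hardy, f ≠ 0 ∧ ‖W f - l • f‖ ≤ D / R * ‖f‖) :
    l ∈ spectrum ℂ W := by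
  rw [spectrum.mem_iff]
  intro hunit
  obtain ⟨V, hV⟩ := hunit.exists_left_inv
  -- Chosen so that `‖V‖ * |D| < R`, which contradicts the estimate `R ≤ ‖V‖ * |D|` obtained below.
  set R : ℝ := ‖V‖ * |D| + 1
  have hR : 1 ≤ R := le_add_of_nonneg_left (by positivity)
  obtain ⟨f, hf, hfn⟩ := happ R hR
  have h1 : V (l • f - W f) = f := by
    have := congrArg (fun A : Hardy →L[ℂ] Hardy => A f) hV
    simpa [Algebra.algebraMap_eq_smul_one] using this
  have hfpos : 0 < ‖f‖ := norm_pos_iff.mpr hf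
  have h2 : ‖f‖ ≤ ‖V‖ * (|D| / R * ‖f‖) := by
    calc ‖f‖ = ‖V (l • f - W f)‖ := by rw [h1]
      _ ≤ ‖V‖ * ‖l • f - W f‖ := V.le_opNorm _
      _ = ‖V‖ * ‖W f - l • f‖ := by rw [norm_sub_rev]
      _ ≤ ‖V‖ * (D / R * ‖f‖) := by gcongr
      _ ≤ ‖V‖ * (|D| / R * ‖f‖) := by gcongr; exact le_abs_self D
  have hR0 : 0 < R := by linarith
  have h3 : R * ‖f‖ ≤ ‖V‖ * |D| * ‖f‖ := by
    calc R * ‖f‖ ≤ R * (‖V‖ * (|D| / R * ‖f‖)) := by gcongr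
      _ = ‖V‖ * |D| * ‖f‖ := by field_simp
  have h4 := le_of_mul_le_mul_right h3 hfpos
  simp only [R] at h4
  linarith

/-- The sign of `s` matters: `exp (-s C)` is bounded on the right half-plane only for `s ≥ 0`. A
full turn added to or subtracted from the argument, according to the sign of `c`, secures it. -/
theorem exists_nonneg_exp_eq {c : ℝ} (hc : c ≠ 0) {a : ℂ} (ha : ‖a‖ = 1) :
    ∃ s : ℝ, 0 ≤ s ∧ Complex.exp (-(s * (c * Complex.I))) = a := by
  have h1 := Complex.norm_mul_exp_arg_mul_I a
  rw [ha, Complex.ofReal_one, one_mul] at h1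
  have hcc : (c : ℂ) ≠ 0 := by exact_mod_cast hc
  have hb := Complex.abs_arg_le_pi a
  have hpi := Real.pi_pos
  rw [abs_le] at hb
  rcases lt_or_gt_of_ne hc with hneg | hpos
  · refine ⟨(-a.arg - 2 * Real.pi) / c, div_nonneg_of_nonpos (by linarith) hneg.le, ?_⟩
    have : (-((((-a.arg - 2 * Real.pi) / c : ℝ) : ℂ) * (c * Complex.I))) =
        a.arg * Complex.I + 2 * Real.pi * Complex.I := by
      push_cast
      field_simp
      ring
    rw [this, Complex.exp_add, Complex.exp_two_pi_mul_I, mul_one, h1]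
  · refine ⟨(2 * Real.pi - a.arg) / c, div_nonneg (by linarith) hpos.le, ?_⟩
    have : (-((((2 * Real.pi - a.arg) / c : ℝ) : ℂ) * (c * Complex.I))) =
        a.arg * Complex.I - 2 * Real.pi * Complex.I := by
      push_cast
      field_simp
      ring
    rw [this, Complex.exp_sub, Complex.exp_two_pi_mul_I, div_one, h1]

theorem le_norm_cayley_add (hω : ‖ω‖ = 1) {R : ℝ} (c : ℝ) {z : ℂ} (hz : z ∈ disc) :
    R ≤ ‖cayley ω z + c * Complex.I + R‖ := by
  refine le_trans ?_ (Complex.re_le_norm _)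
  have := cayley_re_pos hω hz
  simp
  linarith

theorem cayley_add_ne_zero (hω : ‖ω‖ = 1) {R : ℝ} (hR : 0 < R) (c : ℝ) {z : ℂ} (hz : z ∈ disc) :
    cayley ω z + c * Complex.I + R ≠ 0 :=
  norm_pos_iff.mp (hR.trans_le (le_norm_cayley_add hω c hz))

theorem norm_cayley_add_one_le (hω : ‖ω‖ = 1) {R : ℝ} (hR : 1 ≤ R) {z : ℂ} (hz : z ∈ disc) :
    ‖cayley ω z + 1‖ ≤ ‖cayley ω z + R‖ := by
  have := cayley_re_pos hω hz
  rw [← sq_le_sq₀ (norm_nonneg _) (norm_nonneg _), Complex.sq_norm, Complex.sq_norm,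
    Complex.normSq_apply, Complex.normSq_apply]
  simp
  nlinarith

/-- Formally `(C + 1) exp (-s C)` is an eigenfunction for `η⁻¹ exp (-i s c)`, since `C + 1 = 2 ω /
(ω - z)` absorbs the weight up to `η⁻¹`. It is unbounded; dividing by `C + R` makes it bounded, with
a relative error of at most `|c| / R`. -/
theorem IsWeightedComposition.spectrum_of_translation (hW : IsWeightedComposition ψ φ hmaps W)
    (hunitary : W ∈ unitary (Hardy →L[ℂ] Hardy)) (hω : ‖ω‖ = 1) {c : ℝ} (hc : c ≠ 0) {η : ℂ}
    (hη : ‖η‖ = 1) (hcoc : ∀ z ∈ disc, ω - φ z = η * ψ z * (ω - z))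
    (h : ∀ z ∈ disc, cayley ω (φ z) = cayley ω z + c * Complex.I) :
    spectrum ℂ W = sphere (0 : ℂ) 1 := by
  refine Set.Subset.antisymm (spectrum.subset_circle_of_unitary hunitary) fun l hl => ?_
  have hl1 : ‖l‖ = 1 := by simpa using hl
  have hη0 : η ≠ 0 := by rw [← norm_ne_zero_iff, hη]; exact one_ne_zero
  -- The factor `η` compensates the `η⁻¹` produced by the weight.
  obtain ⟨s, hs, hsl⟩ := exists_nonneg_exp_eq hc (a := l * η) (by rw [norm_mul, hl1, hη, mul_one])
  refine mem_spectrum_of_approx (D := |c|) fun R hR => ?_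
  have hR0 : 0 < R := by linarith
  have hne : ∀ z ∈ disc, cayley ω z + R ≠ 0 := fun z hz => by
    simpa using cayley_add_ne_zero hω hR0 0 hz
  have hd := differentiableOn_cayley hω
  obtain ⟨f, hf⟩ := Hardy.exists_of_bounded
    (h := fun z => (cayley ω z + 1) / (cayley ω z + R) * Complex.exp (-(s * cayley ω z)))
    (((hd.add_const 1).fun_div (hd.add_const _) hne).fun_mul (hd.const_mul _).fun_neg.cexp) (C := 1)
    fun z hz => by
      rw [norm_mul, norm_div, Complex.norm_exp]
      have h1 : ‖cayley ω z + 1‖ / ‖cayley ω z + R‖ ≤ 1 :=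
        div_le_one_of_le₀ (norm_cayley_add_one_le hω hR hz) (norm_nonneg _)
      have h2 : Real.exp (-(s * cayley ω z)).re ≤ 1 := by
        rw [Real.exp_le_one_iff]
        simpa using mul_nonneg hs (cayley_re_pos hω hz).le
      exact mul_le_one₀ h1 (Real.exp_pos _).le h2
  -- The multiplier is `l * ((C + R) / (C + i c + R) - 1)`, the exact error when `W` is applied to
  -- `f`.
  obtain ⟨M, hM, hMn⟩ := Hardy.exists_mulOp
    (h := fun z => -(l * (c * Complex.I)) / (cayley ω z + c * Complex.I + R)) (C := |c| / R)
    (DifferentiableOn.fun_div (differentiableOn_const _) ((hd.add_const _).add_const _)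
      fun z hz => cayley_add_ne_zero hω hR0 c hz) (by positivity)
    fun z hz => by
      rw [norm_div, norm_neg, norm_mul, norm_mul, hl1, Complex.norm_I, Complex.norm_real,
        Real.norm_eq_abs, one_mul, mul_one]
      gcongr
      exact le_norm_cayley_add hω c hz
  refine ⟨f, fun h0 => ?_, ?_⟩
  · have h1 := hf ⟨0, by simp⟩
    have h2 := hne 0 (by simp)
    rw [h0] at h1
    simp only [cayley_zero hω] at h1 h2
    refine mul_ne_zero (div_ne_zero ?_ h2) (Complex.exp_ne_zero _) h1.symm
    norm_num
  · have h1 : W f - l • f = M f := by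
      ext z
      have hz := z.2
      have h2 := cayley_add_ne_zero hω hR0 c hz
      have h3 := hne z hz
      have h4 := cayley_add_one hω (hmaps hz)
      have h5 := cayley_add_one hω hz
      have h6 := sub_ne_zero_of_mem_disc hω hz
      have h7 := sub_ne_zero_of_mem_disc hω (hmaps hz)
      have h8 : ψ z * (cayley ω (φ z) + 1) = η⁻¹ * (cayley ω z + 1) := by
        have h9 := hW.ne_zero hunitary hz
        rw [h4, h5, hcoc z hz]
        field_simp
      have h10 : Complex.exp (-(s * cayley ω (φ z))) =
          Complex.exp (-(s * cayley ω z)) * (l * η) := by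
        rw [h z hz, ← hsl, ← Complex.exp_add]
        congr 1
        ring
      rw [Hardy.sub_apply, hW, Hardy.smul_apply, hM, hf, hf, Set.MapsTo.val_restrict_apply, h10,
        ← mul_assoc, ← mul_div_assoc, h8, h z hz]
      field_simp
      ring
    rw [h1]
    exact hMn f

/-- The spectrum of a unitary weighted composition operator whose symbol has its Denjoy-Wolff point
on the unit circle. -/
theorem IsWeightedComposition.spectrum_of_boundary (hW : IsWeightedComposition ψ φ hmaps W)
    (hunitary : W ∈ unitary (Hardy →L[ℂ] Hardy)) (hω : ‖ω‖ = 1) (hDW : IsDenjoyWolffPoint φ ω) :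
    spectrum ℂ W = sphere (0 : ℂ) 1 := by
  obtain ⟨η, hη, hcoc⟩ := hW.exists_boundary_cocycle hunitary hω hDW
  obtain ⟨c, hc⟩ := hW.cayley_comp hunitary hω hη hcoc rfl
  have hηpos : 0 < ‖η‖ := norm_pos_iff.mpr hη
  by_cases hr : (‖η‖ ^ 2)⁻¹ = 1
  · have hη1 : ‖η‖ = 1 := by
      rw [inv_eq_one] at hr
      exact (pow_eq_one_iff_of_nonneg hηpos.le two_ne_zero).mp hr
    rw [hr] at hc
    simp only [Complex.ofReal_one, one_mul] at hc
    -- If `c = 0`, then `φ` would fix `0`, and the orbit of `0` could not reach the unit circle in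
    -- the limit.
    refine hW.spectrum_of_translation hunitary hω (fun hc0 => ?_) hη1 hcoc hc
    have h0 : (0 : ℂ) ∈ disc := by simp
    have hfix : φ 0 = 0 := cayley_injOn hω (hmaps h0) h0 (by simpa [hc0] using hc 0 h0)
    have hlim := hDW 0 h0
    simp only [Function.iterate_fixed hfix] at hlim
    have := tendsto_nhds_unique hlim tendsto_const_nhds
    rw [this, norm_zero] at hω
    exact zero_ne_one hω
  · exact hW.spectrum_of_dilation hunitary hω (by positivity) hr hc

end BoundaryPoint

end WCO

theorem theorem3p4 (ψ φ : ℂ → ℂ)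
    (hψ : DifferentiableOn ℂ ψ WCO.disc) (hφ : DifferentiableOn ℂ φ WCO.disc)
    (hmaps : Set.MapsTo φ WCO.disc WCO.disc)
    (W : WCO.Hardy →L[ℂ] WCO.Hardy) (hW : WCO.IsWeightedComposition ψ φ hmaps W)
    (hunitary : W ∈ unitary (WCO.Hardy →L[ℂ] WCO.Hardy)) :
    (∀ p ∈ WCO.disc, φ p = p →
      ‖deriv φ p‖ = 1 ∧
      spectrum ℂ W = closure (Set.range fun n : ℕ => ψ p * deriv φ p ^ n)) ∧
    (WCO.IsHyperbolic φ ∨ WCO.IsParabolic φ →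
      spectrum ℂ W = Metric.sphere (0 : ℂ) 1) := by
  refine ⟨fun p hp hfix => ⟨(hW.blaschke_comp hunitary hφ hp hfix).1,
    hW.spectrum_of_fixed hunitary hφ hp hfix⟩, ?_⟩
  rintro (⟨ω, hω, hDW, -⟩ | ⟨ω, hω, hDW, -⟩)
  · exact hW.spectrum_of_boundary hunitary hω hDW
  · exact hW.spectrum_of_boundary hunitary hω hDW
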